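/- A computable metric space is a complete metric space $(X,d)$ together with a dense sequence $(q_i)_{i\in\mathbb N}$ of points of $X$, called the special points (repetitions are allowed), such that the distance $d(q_i,q_j)$ is a computable real number uniformly in $i,j$. The space is called perfect if it has no isolated points. A set $\mathcal C\subseteq X$ is a $\Pi^0_1(\emptyset')$ class if there is a set $I\subseteq\mathbb N\times\mathbb N$, computably enumerable relative to the halting problem $\emptyset'$, such that $X\setminus\mathcal C=\bigcup_{(i,j)\in I}B(q_i,2^{-j})$, where $B(q,r)=\{x\in X: d(x,q)<r\}$. A set $D$ of special points is called c.e. if $D=\{q_i: i\in A\}$ for some computably enumerable set $A\subseteq\mathbb N$. **Theorem.** Let $(X,d,(q_i)_{i\in\mathbb N})$ be a perfect computable metric space and let $\mathcal C\subseteq X$ be a $\Pi^0_1(\emptyset')$ class. Then there is a c.e. set $D$ of special points such that $\mathcal C$ is exactly the set of limit points of $D$ in $(X,d)$, that is, the set of all $x\in X$ such that every neighbourhood of $x$ contains a point of $D$ different from $x$. -/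

import Mathlib

/-- A family `(f a)` of real numbers is uniformly computable: from `a` and `n` one can compute a
rational number `(u a n - v a n) / (w a n + 1)`, with `u`, `v`, `w` taking values in `ℕ`, that
approximates `f a` with error at most `2⁻ⁿ`. -/
def UniformlyComputableReal {α : Type*} [Primcodable α] (f : α → ℝ) : Prop :=
  ∃ u v w : α → ℕ → ℕ, Computable₂ u ∧ Computable₂ v ∧ Computable₂ w ∧
    ∀ a n, |f a - ((u a n : ℝ) - (v a n : ℝ)) / ((w a n : ℝ) + 1)| ≤ (1 / 2 : ℝ) ^ n

/-- `(X, d, (q i))` is a computable metric space: a Polish metric space (complete, and separable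
because of `q`) with a designated dense sequence `q` of special points such that the distance
`d (q i) (q j)` is a computable real uniformly in `i`, `j`. The sequence may have repetitions. -/
structure IsComputableMetricSpace (X : Type*) [MetricSpace X] (q : ℕ → X) : Prop where
  complete : CompleteSpace X
  dense : DenseRange q
  computable_dist : UniformlyComputableReal fun p : ℕ × ℕ => dist (q p.1) (q p.2)

/-- The halting problem `∅'`: the set of all `e` such that the `e`-th partial computable function
is defined at `e`. -/
def haltingSet : Set ℕ :=
  {e | ((Denumerable.ofNat Nat.Partrec.Code e).eval e).Dom}

open Classical in
/-- The characteristic function of a set of natural numbers. -/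
noncomputable def charFun (A : Set ℕ) : ℕ → ℕ :=
  fun n => if n ∈ A then 1 else 0

/-- A predicate is computably enumerable relative to `A`, i.e. `Σ⁰₁(A)`, if it is the domain of a
partial function that is computable with oracle `A` (compare `REPred`). -/
def REPredIn {α : Type*} [Primcodable α] (A : Set ℕ) (p : α → Prop) : Prop :=
  RecursiveIn {(charFun A : ℕ →. ℕ)} fun a => Part.assert (p a) fun _ => Part.some ()

/-- `C ⊆ X` is a `Π⁰₁(A)` class with respect to the special points `q`: its complement is the union
of a family, computably enumerable relative to `A`, of basic open balls `B(q i, 2⁻ʲ)`. -/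
def IsPi01ClassIn {X : Type*} [MetricSpace X] (q : ℕ → X) (A : Set ℕ) (C : Set X) : Prop :=
  ∃ I : Set (ℕ × ℕ), REPredIn A (fun k => k ∈ I) ∧
    Cᶜ = ⋃ k ∈ I, Metric.ball (q k.1) ((1 / 2 : ℝ) ^ k.2)

/-- `D` is a computably enumerable set of special points: it consists of the points `q i` with `i`
in some computably enumerable set of indices. -/
def IsCESetOfSpecialPoints {X : Type*} (q : ℕ → X) (D : Set X) : Prop :=
  ∃ A : Set ℕ, REPred (fun i => i ∈ A) ∧ D = q '' A

/-! By the easy half of Post's theorem (`REPredIn.isSigma2`) the removed balls form a `Σ⁰₂` family,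
so each pair of a ball and a witness is either valid or refuted at a finite stage. Candidates are
triples (level `m`, index `i`, precision `s`). One is admitted if, for each of the first `m` pairs,
the pair is refuted by stage `s` or `q i` is visibly outside the ball up to error `2⁻ᵐ`. It must
also be visibly distinct from all earlier selections, and more than `2⁻⁽ᵐ⁺¹⁾` from those of its own
level. A point inside a valid ball is eventually avoided by all high levels, and separation leaves
finitely many selections near it at low levels (`notMem_derivedSet_of_separated_levels`). Near a
point of `C`, candidates eventually pass the ball test, so only an already selected nearby point can
block them; perfectness supplies candidates other than the point itself
(`mem_derivedSet_of_greedy`). -/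

open Encodable Denumerable

/-! ### Closure properties of `Σ⁰₂` predicates. -/

/-- A predicate is `Σ⁰₂`. -/
def IsSigma2 {α : Type*} [Primcodable α] (p : α → Prop) : Prop :=
  ∃ R : α × ℕ × ℕ → Bool, Computable R ∧ ∀ a, p a ↔ ∃ m, ∀ n, R (a, m, n) = true

namespace IsSigma2

variable {α β : Type*} [Primcodable α] [Primcodable β]

theorem of_iff {p p' : α → Prop} (hp : IsSigma2 p) (h : ∀ a, p' a ↔ p a) : IsSigma2 p' := by
  obtain ⟨R, hR, H⟩ := hp
  exact ⟨R, hR, fun a => (h a).trans (H a)⟩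

theorem of_exists {R : α × ℕ → Bool} (hR : Computable R) :
    IsSigma2 fun a => ∃ m, R (a, m) = true :=
  ⟨fun x => R (x.1, x.2.1), hR.comp (Computable.fst.pair (Computable.fst.comp Computable.snd)),
    fun a => by simp⟩

theorem of_forall {R : α × ℕ → Bool} (hR : Computable R) :
    IsSigma2 fun a => ∀ n, R (a, n) = true :=
  ⟨fun x => R (x.1, x.2.2), hR.comp (Computable.fst.pair (Computable.snd.comp Computable.snd)),
    fun a => by simp⟩

theorem of_bool {R : α → Bool} (hR : Computable R) : IsSigma2 fun a => R a = true :=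
  ⟨fun x => R x.1, hR.comp Computable.fst, fun a => by simp⟩

theorem of_primrecPred {p : α → Prop} (hp : PrimrecPred p) : IsSigma2 p := by
  classical
  exact (of_bool hp.decide.to_comp).of_iff fun a => by simp

theorem comp {p : β → Prop} (hp : IsSigma2 p) {f : α → β} (hf : Computable f) :
    IsSigma2 fun a => p (f a) := by
  obtain ⟨R, hR, H⟩ := hp
  exact ⟨fun x => R (f x.1, x.2), hR.comp ((hf.comp Computable.fst).pair Computable.snd),
    fun a => H (f a)⟩

theorem and {p p' : α → Prop} (hp : IsSigma2 p) (hp' : IsSigma2 p') :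
    IsSigma2 fun a => p a ∧ p' a := by
  obtain ⟨R, hR, H⟩ := hp
  obtain ⟨R', hR', H'⟩ := hp'
  have hm : Computable fun x : α × ℕ × ℕ => x.2.1.unpair :=
    Computable.unpair.comp (Computable.fst.comp Computable.snd)
  have hn : Computable fun x : α × ℕ × ℕ => x.2.2 := Computable.snd.comp Computable.snd
  refine ⟨fun x => R (x.1, x.2.1.unpair.1, x.2.2) && R' (x.1, x.2.1.unpair.2, x.2.2), ?_, ?_⟩
  · exact Primrec.and.to_comp.comp
      (hR.comp (Computable.fst.pair ((Computable.fst.comp hm).pair hn)))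
      (hR'.comp (Computable.fst.pair ((Computable.snd.comp hm).pair hn)))
  · intro a
    simp only [H, H', Bool.and_eq_true]
    constructor
    · rintro ⟨⟨m, hm⟩, m', hm'⟩
      exact ⟨Nat.pair m m', fun n => by simpa using ⟨hm n, hm' n⟩⟩
    · rintro ⟨m, hm⟩
      exact ⟨⟨_, fun n => (hm n).1⟩, _, fun n => (hm n).2⟩

theorem or {p p' : α → Prop} (hp : IsSigma2 p) (hp' : IsSigma2 p') :
    IsSigma2 fun a => p a ∨ p' a := by
  obtain ⟨R, hR, H⟩ := hp
  obtain ⟨R', hR', H'⟩ := hp'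
  have hm : Computable fun x : α × ℕ × ℕ => x.2.1.div2 :=
    Computable.nat_div2.comp (Computable.fst.comp Computable.snd)
  have hx : Computable fun x : α × ℕ × ℕ => (x.1, x.2.1.div2, x.2.2) :=
    Computable.fst.pair (hm.pair (Computable.snd.comp Computable.snd))
  refine ⟨fun x => cond x.2.1.bodd (R (x.1, x.2.1.div2, x.2.2)) (R' (x.1, x.2.1.div2, x.2.2)),
    Computable.cond (Computable.nat_bodd.comp (Computable.fst.comp Computable.snd))
      (hR.comp hx) (hR'.comp hx), ?_⟩
  intro a
  simp only [H, H']
  constructor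
  · rintro (⟨m, hm⟩ | ⟨m, hm⟩)
    · exact ⟨Nat.bit true m, fun n => by simpa [Nat.bodd_bit, Nat.div2_bit] using hm n⟩
    · exact ⟨Nat.bit false m, fun n => by simpa [Nat.bodd_bit, Nat.div2_bit] using hm n⟩
  · rintro ⟨m, hm⟩
    cases h : m.bodd
    · exact Or.inr ⟨m.div2, fun n => by simpa [h] using hm n⟩
    · exact Or.inl ⟨m.div2, fun n => by simpa [h] using hm n⟩

theorem exists_nat {p : α × ℕ → Prop} (hp : IsSigma2 p) : IsSigma2 fun a => ∃ k, p (a, k) := by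
  obtain ⟨R, hR, H⟩ := hp
  have hm : Computable fun x : α × ℕ × ℕ => x.2.1.unpair :=
    Computable.unpair.comp (Computable.fst.comp Computable.snd)
  refine ⟨fun x => R ((x.1, x.2.1.unpair.1), x.2.1.unpair.2, x.2.2),
    hR.comp ((Computable.fst.pair (Computable.fst.comp hm)).pair
      ((Computable.snd.comp hm).pair (Computable.snd.comp Computable.snd))), fun a => ?_⟩
  simp only [H]
  constructor
  · rintro ⟨k, m, h⟩
    exact ⟨Nat.pair k m, by simpa using h⟩
  · rintro ⟨m, h⟩
    exact ⟨_, _, h⟩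

theorem exists_denumerable {γ : Type*} [Denumerable γ] {p : α × γ → Prop} (hp : IsSigma2 p) :
    IsSigma2 fun a => ∃ c, p (a, c) := by
  have h := (hp.comp (f := fun x : α × ℕ => (x.1, ofNat γ x.2))
    (Computable.fst.pair ((Computable.ofNat γ).comp Computable.snd))).exists_nat
  refine h.of_iff fun a => ⟨?_, ?_⟩
  · rintro ⟨c, hc⟩
    exact ⟨encode c, by simpa using hc⟩
  · rintro ⟨n, hn⟩
    exact ⟨_, hn⟩

/-- The finitely many witnesses are coded as one list, and the two universal quantifiers merge
through `Nat.unpair`. -/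
theorem forall_lt {p : α × ℕ → Prop} (hp : IsSigma2 p) {f : α → ℕ} (hf : Computable f) :
    IsSigma2 fun a => ∀ k < f a, p (a, k) := by
  obtain ⟨R, hR, H⟩ := hp
  have hn : Computable fun x : α × ℕ × ℕ => x.2.2.unpair :=
    Computable.unpair.comp (Computable.snd.comp Computable.snd)
  have hk : Computable fun x : α × ℕ × ℕ => x.2.2.unpair.1 := Computable.fst.comp hn
  have hl : Computable fun x : α × ℕ × ℕ => (ofNat (List ℕ) x.2.1).getD x.2.2.unpair.1 0 :=
    (Primrec.list_getD 0).to_comp.comp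
      ((Computable.ofNat (List ℕ)).comp (Computable.fst.comp Computable.snd)) hk
  refine ⟨fun x => cond (decide (x.2.2.unpair.1 < f x.1))
      (R ((x.1, x.2.2.unpair.1), (ofNat (List ℕ) x.2.1).getD x.2.2.unpair.1 0, x.2.2.unpair.2))
      true, ?_, fun a => ?_⟩
  · exact Computable.cond (Primrec.nat_lt.decide.to_comp.comp hk (hf.comp Computable.fst))
      (hR.comp ((Computable.fst.pair hk).pair (hl.pair (Computable.snd.comp hn))))
      (Computable.const true)
  · simp only [H]
    constructor
    · intro h
      choose! g hg using h
      refine ⟨encode ((List.range (f a)).map g), fun n => ?_⟩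
      by_cases hlt : n.unpair.1 < f a
      · simpa [hlt] using hg _ hlt n.unpair.2
      · simp [hlt]
    · rintro ⟨m, hm⟩ k hk
      exact ⟨_, fun n => by simpa [hk] using hm (Nat.pair k n)⟩

end IsSigma2

/-! ### From recursive in the halting set to `Σ⁰₂`. -/

theorem haltingSet_iff (x : ℕ) :
    x ∈ haltingSet ↔ ∃ k, (Nat.Partrec.Code.evaln k (ofNat Nat.Partrec.Code x) x).isSome = true := by
  simp only [haltingSet, Set.mem_ofPred_eq, Part.dom_iff_mem, Nat.Partrec.Code.evaln_complete,
    Option.isSome_iff_exists, Option.mem_def]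
  exact exists_comm

theorem computable_isSome_evaln_self :
    Computable fun x : ℕ × ℕ =>
      (Nat.Partrec.Code.evaln x.2 (ofNat Nat.Partrec.Code x.1) x.1).isSome :=
  Primrec.option_isSome.to_comp.comp (Nat.Partrec.Code.primrec_evaln.to_comp.comp
    ((Computable.snd.pair ((Computable.ofNat _).comp Computable.fst)).pair Computable.fst))

theorem isSigma2_mem_haltingSet : IsSigma2 fun x => x ∈ haltingSet :=
  (IsSigma2.of_exists computable_isSome_evaln_self).of_iff haltingSet_iff

theorem isSigma2_notMem_haltingSet : IsSigma2 fun x => x ∉ haltingSet :=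
  (IsSigma2.of_forall (Primrec.not.to_comp.comp computable_isSome_evaln_self)).of_iff fun x => by
    simp [haltingSet_iff]

/-- Listing the intermediate values turns a recursion into an existential over lists with a bounded
quantifier, which `Σ⁰₂` absorbs. -/
theorem mem_prec_iff_exists_list {f h : ℕ →. ℕ} (a n y : ℕ) :
    y ∈ (n.rec (f a) fun k IH => IH.bind fun i => h (Nat.pair a (Nat.pair k i)) : Part ℕ) ↔
      ∃ l : List ℕ, (l.getD 0 0 ∈ f a ∧ l.getD n 0 = y) ∧
        ∀ k < n, l.getD (k + 1) 0 ∈ h (Nat.pair a (Nat.pair k (l.getD k 0))) := by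
  constructor
  · intro hy
    suffices H : ∃ g : ℕ → ℕ, g 0 ∈ f a ∧ g n = y ∧
        ∀ k < n, g (k + 1) ∈ h (Nat.pair a (Nat.pair k (g k))) by
      obtain ⟨g, h0, hn, hs⟩ := H
      have hg : ∀ k ≤ n, ((List.range (n + 1)).map g).getD k 0 = g k := fun k hk => by
        simp [List.getD, Nat.lt_succ_of_le hk]
      refine ⟨(List.range (n + 1)).map g, ⟨?_, ?_⟩, fun k hk => ?_⟩
      · rwa [hg 0 (Nat.zero_le _)]
      · rw [hg n le_rfl, hn]
      · rw [hg _ hk, hg _ hk.le]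
        exact hs k hk
    induction n generalizing y with
    | zero => exact ⟨fun _ => y, hy, rfl, fun k hk => absurd hk (Nat.not_lt_zero k)⟩
    | succ n ih =>
      obtain ⟨i, hi, hy⟩ := Part.mem_bind_iff.1 hy
      obtain ⟨g, h0, hn, hs⟩ := ih i hi
      refine ⟨Function.update g (n + 1) y, ?_, by simp, fun k hk => ?_⟩
      · simpa [Function.update] using h0
      · rcases Nat.lt_succ_iff_lt_or_eq.1 hk with hk | rfl
        · rw [Function.update_of_ne (by omega), Function.update_of_ne (by omega)]
          exact hs k hk
        · simpa [hn] using hy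
  · rintro ⟨l, ⟨h0, hn⟩, hs⟩
    subst hn
    induction n with
    | zero => exact h0
    | succ n ih =>
      exact Part.mem_bind_iff.2 ⟨_, ih fun k hk => hs k (Nat.lt_succ_of_lt hk), hs n n.lt_succ_self⟩

/-- The graph of a partial function that is recursive in the halting problem is `Σ⁰₂`. -/
theorem isSigma2_graph_of_recursiveIn {f : ℕ →. ℕ}
    (hf : Nat.RecursiveIn {(charFun haltingSet : ℕ →. ℕ)} f) :
    IsSigma2 fun x : ℕ × ℕ => x.2 ∈ f x.1 := by
  have c1 : Computable (Prod.fst : ℕ × ℕ → ℕ) := Computable.fst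
  have c2 : Computable (Prod.snd : ℕ × ℕ → ℕ) := Computable.snd
  induction hf with
  | zero =>
    exact (IsSigma2.of_primrecPred (Primrec.eq.comp Primrec.snd (Primrec.const 0))).of_iff
      fun x => Part.mem_some_iff
  | succ =>
    exact (IsSigma2.of_primrecPred
      (Primrec.eq.comp Primrec.snd (Primrec.succ.comp Primrec.fst))).of_iff
      fun x => Part.mem_some_iff
  | left =>
    exact (IsSigma2.of_primrecPred (Primrec.eq.comp Primrec.snd
      (Primrec.fst.comp (Primrec.unpair.comp Primrec.fst)))).of_iff fun x => Part.mem_some_iff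
  | right =>
    exact (IsSigma2.of_primrecPred (Primrec.eq.comp Primrec.snd
      (Primrec.snd.comp (Primrec.unpair.comp Primrec.fst)))).of_iff fun x => Part.mem_some_iff
  | oracle g hg =>
    -- Membership in the halting set and its negation are both `Σ⁰₂`, hence so is the graph of its
    -- characteristic function.
    obtain rfl := Set.mem_singleton_iff.1 hg
    have h1 : IsSigma2 fun x : ℕ × ℕ => x.2 = 1 :=
      .of_primrecPred (Primrec.eq.comp Primrec.snd (Primrec.const 1))
    have h0 : IsSigma2 fun x : ℕ × ℕ => x.2 = 0 :=
      .of_primrecPred (Primrec.eq.comp Primrec.snd (Primrec.const 0))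
    refine (((isSigma2_mem_haltingSet.comp c1).and h1).or
      ((isSigma2_notMem_haltingSet.comp c1).and h0)).of_iff fun x => ?_
    by_cases hx : x.1 ∈ haltingSet <;> simp [charFun, hx]
  | @pair f h _ _ ihf ihh =>
    have p1 : Computable fun x : (ℕ × ℕ) × ℕ => (x.1.1, x.2.unpair.1) :=
      (c1.comp Computable.fst).pair (c1.comp (Computable.unpair.comp Computable.snd))
    have p2 : Computable fun x : (ℕ × ℕ) × ℕ => (x.1.1, x.2.unpair.2) :=
      (c1.comp Computable.fst).pair (c2.comp (Computable.unpair.comp Computable.snd))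
    have p3 : IsSigma2 fun x : (ℕ × ℕ) × ℕ => x.1.2 = x.2 :=
      .of_primrecPred (Primrec.eq.comp (Primrec.snd.comp Primrec.fst) Primrec.snd)
    refine (((ihf.comp p1).and (ihh.comp p2)).and p3).exists_nat.of_iff fun x => ?_
    simp only [Seq.seq, Part.map_eq_map, Part.mem_bind_iff, Part.mem_map_iff]
    constructor
    · rintro ⟨_, ⟨a, ha, rfl⟩, b, hb, hab⟩
      exact ⟨Nat.pair a b, by simpa using ⟨ha, hb⟩, hab.symm⟩
    · rintro ⟨c, ⟨ha, hb⟩, hc⟩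
      exact ⟨_, ⟨_, ha, rfl⟩, _, hb, by simpa using hc.symm⟩
  | @comp f h _ _ ihf ihh =>
    have p1 : Computable fun x : (ℕ × ℕ) × ℕ => (x.1.1, x.2) :=
      (c1.comp Computable.fst).pair Computable.snd
    have p2 : Computable fun x : (ℕ × ℕ) × ℕ => (x.2, x.1.2) :=
      Computable.snd.pair (c2.comp Computable.fst)
    exact ((ihh.comp p1).and (ihf.comp p2)).exists_nat.of_iff fun x => Part.mem_bind_iff
  | @prec f h _ _ ihf ihh =>
    have l1 : Computable fun x : (ℕ × ℕ) × List ℕ => x.1.1.unpair.1 :=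
      c1.comp (Computable.unpair.comp (c1.comp Computable.fst))
    have l2 : Computable fun x : (ℕ × ℕ) × List ℕ => x.1.1.unpair.2 :=
      c2.comp (Computable.unpair.comp (c1.comp Computable.fst))
    have gd : Computable₂ fun (l : List ℕ) (n : ℕ) => l.getD n 0 := (Primrec.list_getD 0).to_comp
    have p1 : Computable fun x : (ℕ × ℕ) × List ℕ => (x.1.1.unpair.1, x.2.getD 0 0) :=
      l1.pair (gd.comp Computable.snd (Computable.const 0))
    have p2 : IsSigma2 fun x : (ℕ × ℕ) × List ℕ => x.2.getD x.1.1.unpair.2 0 = x.1.2 :=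
      .of_primrecPred (Primrec.eq.comp ((Primrec.list_getD 0).comp Primrec.snd
        (Primrec.snd.comp (Primrec.unpair.comp (Primrec.fst.comp Primrec.fst))))
        (Primrec.snd.comp Primrec.fst))
    have p3 : Computable fun x : ((ℕ × ℕ) × List ℕ) × ℕ =>
        (Nat.pair x.1.1.1.unpair.1 (Nat.pair x.2 (x.1.2.getD x.2 0)), x.1.2.getD (x.2 + 1) 0) :=
      (Primrec₂.natPair.to_comp.comp (l1.comp Computable.fst)
        (Primrec₂.natPair.to_comp.comp Computable.snd
          (gd.comp (Computable.snd.comp Computable.fst) Computable.snd))).pair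
        (gd.comp (Computable.snd.comp Computable.fst) (Computable.succ.comp Computable.snd))
    exact (((ihf.comp p1).and p2).and ((ihh.comp p3).forall_lt l2)).exists_denumerable.of_iff
      fun x => mem_prec_iff_exists_list _ _ _
  | @rfind f _ ihf =>
    have p1 : Computable fun x : ℕ × ℕ => (Nat.pair x.1 x.2, 0) :=
      (Primrec₂.natPair.to_comp.comp c1 c2).pair (Computable.const 0)
    have p2 : Computable fun x : ((ℕ × ℕ) × ℕ) × ℕ => (Nat.pair x.1.1.1 x.1.2, x.2 + 1) :=
      (Primrec₂.natPair.to_comp.comp (c1.comp (Computable.fst.comp Computable.fst))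
        (Computable.snd.comp Computable.fst)).pair (Computable.succ.comp Computable.snd)
    refine ((ihf.comp p1).and ((ihf.comp p2).exists_nat.forall_lt c2)).of_iff fun x => ?_
    refine Nat.mem_rfind.trans (and_congr ?_ (forall₂_congr fun k _ => ?_))
    · simp
    · simp only [Part.map_eq_map, Part.mem_map_iff, decide_eq_false_iff_not]
      constructor
      · rintro ⟨z, hz, hz0⟩
        obtain ⟨n, rfl⟩ := Nat.exists_eq_succ_of_ne_zero hz0
        exact ⟨n, hz⟩
      · rintro ⟨n, hn⟩
        exact ⟨_, hn, n.succ_ne_zero⟩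

/-- A predicate that is computably enumerable relative to the halting problem is `Σ⁰₂`. -/
theorem REPredIn.isSigma2 {α : Type*} [Primcodable α] {p : α → Prop}
    (hp : REPredIn haltingSet p) : IsSigma2 p := by
  -- The only possible output is `()`, whose code is 0.
  have h := (isSigma2_graph_of_recursiveIn hp).comp
    (f := fun a : α => (encode a, 0)) (Computable.encode.pair (Computable.const 0))
  refine h.of_iff fun a => ?_
  simp only [encodek, Part.coe_some, Part.bind_some, Part.assert, Part.mem_map_iff]
  exact ⟨fun h => ⟨(), ⟨⟨h, trivial⟩, rfl⟩, rfl⟩, fun ⟨_, ⟨⟨h, _⟩, _⟩, _⟩ => h⟩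

/-! ### Computable search, greedy selection and comparison of reals. -/

theorem Computable.decide_forall_lt {α : Type*} [Primcodable α] {p : α × ℕ → Bool}
    (hp : Computable p) {f : α → ℕ} (hf : Computable f) :
    Computable fun a => decide (∀ k < f a, p (a, k) = true) := by
  have h : Computable₂ fun (a : α) (x : ℕ × Bool) => x.2 && p (a, x.1) :=
    Primrec.and.to_comp.comp (Computable.snd.comp Computable.snd)
      (hp.comp (Computable.fst.pair (Computable.fst.comp Computable.snd)))
  refine (Computable.nat_rec hf (Computable.const true) h).of_eq fun a => ?_
  induction f a with
  | zero => simp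
  | succ n ih =>
    simp only [ih, Nat.forall_lt_succ_right, Bool.decide_and, Bool.decide_eq_true]

theorem REPred.of_exists {α : Type*} [Primcodable α] {R : α × ℕ → Bool} (hR : Computable R) :
    REPred fun a => ∃ n, R (a, n) = true := by
  have h : Partrec fun a => Nat.rfind fun n => Part.some (R (a, n)) := Partrec.rfind hR.partrec.to₂
  refine h.dom_re.of_eq fun a => ?_
  exact Nat.rfind_dom'.trans ⟨fun ⟨n, hn, _⟩ => ⟨n, (Part.mem_some_iff.1 hn).symm⟩,
    fun ⟨n, hn⟩ => ⟨n, Part.mem_some_iff.2 hn.symm, fun _ => trivial⟩⟩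

/-- Going through the natural numbers in order, one can computably and greedily select those that
satisfy `T` and are compatible with all numbers selected before. -/
theorem exists_computable_greedy {T : ℕ → Bool} {S : ℕ × ℕ → Bool} (hT : Computable T)
    (hS : Computable S) :
    ∃ b : ℕ → Bool, Computable b ∧
      ∀ t, b t = true ↔ T t = true ∧ ∀ k < t, b k = true → S (k, t) = true := by
  let b : ℕ → Bool := fun t => Nat.strongRec
    (fun t ih => T t && decide (∀ k (hk : k < t), ih k hk = true → S (k, t) = true)) t
  have hb : ∀ t, b t = (T t && decide (∀ k < t, b k = true → S (k, t) = true)) := fun t => by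
    simp only [b]
    rw [Nat.strongRec]
  refine ⟨b, ?_, fun t => by rw [hb]; simp⟩
  -- The list holds the earlier decisions, so its length is the current stage.
  let g : Unit → List Bool → Option Bool := fun _ l => some (T l.length &&
    decide (∀ k < l.length, (!(l.getD k false) || S (k, l.length)) = true))
  have hlen : Computable fun x : Unit × List Bool => x.2.length :=
    Computable.list_length.comp Computable.snd
  have hg : Computable₂ g := by
    refine Computable.option_some.comp (Primrec.and.to_comp.comp (hT.comp hlen)
      (Computable.decide_forall_lt (p := fun x : (Unit × List Bool) × ℕ =>
        !(x.1.2.getD x.2 false) || S (x.2, x.1.2.length)) ?_ hlen))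
    exact Primrec.or.to_comp.comp
      (Primrec.not.to_comp.comp ((Primrec.list_getD false).to_comp.comp
        (Computable.snd.comp Computable.fst) Computable.snd))
      (hS.comp (Computable.snd.pair (hlen.comp Computable.fst)))
  have := Computable.nat_strong_rec (fun _ : Unit => b) hg fun _ n => by
    simp only [g, List.length_map, List.length_range, Option.some.injEq]
    rw [hb n]
    congr 2
    refine propext (forall₂_congr fun k hk => ?_)
    simp only [List.getD, List.getElem?_map, List.getElem?_range hk, Option.map_some,
      Option.getD_some]
    cases b k <;> simp
  exact this.comp (Computable.const ()) Computable.id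

/-- For a uniformly computable family of reals one can computably test, up to an error controlled by
`s`, whether a member exceeds `2⁻ʲ - 2⁻ᵐ`. -/
theorem UniformlyComputableReal.exists_test {α : Type*} [Primcodable α] {f : α → ℝ}
    (hf : UniformlyComputableReal f) :
    ∃ F : α × (ℕ × ℕ) × ℕ → Bool, Computable F ∧
      (∀ a j m s, F (a, (j, m), s) = true → (1 / 2 : ℝ) ^ j - (1 / 2) ^ m < f a) ∧
      ∀ a j m s, (1 / 2 : ℝ) ^ j - (1 / 2) ^ m + 2 * (1 / 2) ^ s < f a →
        F (a, (j, m), s) = true := by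
  obtain ⟨u, v, w, hu, hv, hw, h⟩ := hf
  -- This compares the approximation with `2⁻ʲ - 2⁻ᵐ + 2⁻ˢ`, multiplied by `2^(j+m+s) * (w+1)` and
  -- with negative terms moved across, so that it lives in `ℕ`.
  let F : α × (ℕ × ℕ) × ℕ → Bool := fun x => decide
    (v x.1 x.2.2 * 2 ^ (x.2.1.1 + x.2.1.2 + x.2.2) +
      (w x.1 x.2.2 + 1) * (2 ^ (x.2.1.2 + x.2.2) + 2 ^ (x.2.1.1 + x.2.1.2)) <
    u x.1 x.2.2 * 2 ^ (x.2.1.1 + x.2.1.2 + x.2.2) +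
      (w x.1 x.2.2 + 1) * 2 ^ (x.2.1.1 + x.2.2))
  have hF : ∀ a j m s, F (a, (j, m), s) = true ↔ (1 / 2 : ℝ) ^ j - (1 / 2) ^ m + (1 / 2) ^ s <
      ((u a s : ℝ) - v a s) / (w a s + 1) := by
    intro a j m s
    have hw0 : (0 : ℝ) < (w a s : ℝ) + 1 := by positivity
    rw [lt_div_iff₀ hw0, ← sub_pos (b := _ * _)]
    simp only [F, decide_eq_true_eq]
    rw [← Nat.cast_lt (α := ℝ), ← sub_pos]
    push_cast
    have key : (u a s : ℝ) * 2 ^ (j + m + s) + (w a s + 1) * 2 ^ (j + s) -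
        (v a s * 2 ^ (j + m + s) + (w a s + 1) * (2 ^ (m + s) + 2 ^ (j + m))) =
        2 ^ (j + m + s) * ((u a s : ℝ) - v a s -
          ((1 / 2 : ℝ) ^ j - (1 / 2) ^ m + (1 / 2) ^ s) * (w a s + 1)) := by
      simp only [one_div, inv_pow, pow_add]
      field_simp
      ring
    rw [key]
    exact mul_pos_iff_of_pos_left (by positivity)
  refine ⟨F, ?_, fun a j m s hs => ?_, fun a j m s hs => ?_⟩
  · have ca : Computable fun x : α × (ℕ × ℕ) × ℕ => x.1 := Computable.fst
    have cs : Computable fun x : α × (ℕ × ℕ) × ℕ => x.2.2 := Computable.snd.comp Computable.snd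
    have cj : Computable fun x : α × (ℕ × ℕ) × ℕ => x.2.1.1 :=
      Computable.fst.comp (Computable.fst.comp Computable.snd)
    have cm : Computable fun x : α × (ℕ × ℕ) × ℕ => x.2.1.2 :=
      Computable.snd.comp (Computable.fst.comp Computable.snd)
    have add : Computable₂ ((· + ·) : ℕ → ℕ → ℕ) := Primrec.nat_add.to_comp
    have mul : Computable₂ ((· * ·) : ℕ → ℕ → ℕ) := Primrec.nat_mul.to_comp
    have pow : Computable fun n : ℕ => 2 ^ n :=
      ((Primrec₂.unpaired'.1 Nat.Primrec.pow).comp (Primrec.const 2) Primrec.id).to_comp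
    have cw : Computable fun x : α × (ℕ × ℕ) × ℕ => w x.1 x.2.2 + 1 :=
      Computable.succ.comp (hw.comp ca cs)
    have cp := pow.comp (add.comp (add.comp cj cm) cs)
    exact Primrec.nat_lt.decide.to_comp.comp
      (add.comp (mul.comp (hv.comp ca cs) cp)
        (mul.comp cw (add.comp (pow.comp (add.comp cm cs)) (pow.comp (add.comp cj cm)))))
      (add.comp (mul.comp (hu.comp ca cs) cp) (mul.comp cw (pow.comp (add.comp cj cs))))
  · have h1 := (hF a j m s).1 hs
    have h2 := (abs_le.1 (h a s)).1
    linarith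
  · have h2 := (abs_le.1 (h a s)).2
    exact (hF a j m s).2 (by linarith)

/-! ### Limit points of separated and of greedy selections. -/

theorem notMem_derivedSet_of_separated_levels {X : Type*} [MetricSpace X] {p : ℕ → X} {lev : ℕ → ℕ}
    {B : Set ℕ} (hsep : ∀ t ∈ B, ∀ t' ∈ B, t < t' → lev t = lev t' →
      (1 / 2 : ℝ) ^ (lev t + 1) < dist (p t') (p t))
    {y : X} {η : ℝ} (hη : 0 < η) {M : ℕ} (hfar : ∀ t ∈ B, M ≤ lev t → η ≤ dist (p t) y) :
    y ∉ derivedSet (p '' B) := by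
  have hε : 0 < min η ((1 / 2 : ℝ) ^ (M + 2)) := by positivity
  -- Only levels below `M` reach this ball, whose diameter is too small for two selections of one
  -- level.
  have hfin : (B ∩ {t | dist (p t) y < min η ((1 / 2 : ℝ) ^ (M + 2))}).Finite := by
    refine Set.Finite.of_finite_image (f := lev) (Set.Finite.subset (Set.finite_Iio M) ?_) ?_
    · rintro _ ⟨t, ⟨ht, hd⟩, rfl⟩
      by_contra hM
      exact absurd (hfar t ht (not_lt.1 hM)) (not_le.2 (hd.trans_le (min_le_left _ _)))
    · have hlt : ∀ t ∈ B ∩ {t | dist (p t) y < min η ((1 / 2 : ℝ) ^ (M + 2))},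
          ∀ t' ∈ B ∩ {t | dist (p t) y < min η ((1 / 2 : ℝ) ^ (M + 2))},
          lev t = lev t' → ¬ t < t' := by
        rintro t ⟨ht, hd⟩ t' ⟨ht', hd'⟩ hl hlt
        rw [Set.mem_ofPred_eq] at hd hd'
        have hM : lev t < M := by
          by_contra hM
          exact absurd (hfar t ht (not_lt.1 hM)) (not_le.2 (hd.trans_le (min_le_left _ _)))
        have h1 := hsep t ht t' ht' hlt hl
        have h2 : (1 / 2 : ℝ) ^ (M + 1) ≤ (1 / 2) ^ (lev t + 1) :=
          pow_le_pow_of_le_one (by norm_num) (by norm_num) (by omega)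
        have h3 : (1 / 2 : ℝ) ^ (M + 1) = 2 * (1 / 2) ^ (M + 2) := by ring
        have h4 := hd.trans_le (min_le_right _ _)
        have h5 := hd'.trans_le (min_le_right _ _)
        have h6 := dist_triangle_right (p t') (p t) y
        linarith
      intro t ht t' ht' hl
      rcases lt_trichotomy t t' with h | h | h
      · exact absurd h (hlt t ht t' ht' hl)
      · exact h
      · exact absurd h (hlt t' ht' t ht hl.symm)
  intro hy
  rw [mem_derivedSet, accPt_iff_nhds] at hy
  have hclosed := ((hfin.image p).subset (Set.sdiff_subset (t := {y}))).isClosed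
  obtain ⟨z, ⟨⟨hz1, hz2⟩, t, ht, rfl⟩, hne⟩ := hy _ (Filter.inter_mem
    (Metric.ball_mem_nhds y hε) (hclosed.isOpen_compl.mem_nhds fun h => h.2 rfl))
  exact hz2 ⟨⟨t, ⟨ht, hz1⟩, rfl⟩, hne⟩

theorem eventually_two_mul_pow_lt {δ : ℝ} (hδ : 0 < δ) :
    ∀ᶠ s : ℕ in Filter.atTop, 2 * (1 / 2 : ℝ) ^ s < δ := by
  have h := (tendsto_pow_atTop_nhds_zero_of_lt_one (r := (1 / 2 : ℝ))
    (by norm_num) (by norm_num)).const_mul 2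
  rw [mul_zero] at h
  exact h.eventually_lt_const hδ

/-- A greedy selection of points, where `lev t` is the scale and `s` the precision at which the
candidate `q i` is examined, accumulates at `x` if candidates close to `x` are rejected only because
of lack of separation from the points selected before. -/
theorem mem_derivedSet_of_greedy {X : Type*} [MetricSpace X] [PerfectSpace X] {q : ℕ → X}
    (hq : DenseRange q) {p : ℕ → X} {lev : ℕ → ℕ} {B : Set ℕ}
    (hinj : ∀ t ∈ B, ∀ t' ∈ B, t < t' → p t' ≠ p t) {c : ℕ → ℕ → ℕ → ℕ}
    (hp : ∀ m i s, p (c m i s) = q i) {x : X}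
    (hx : ∀ m i, dist (q i) x < (1 / 2 : ℝ) ^ m → ∀ᶠ s in Filter.atTop, c m i s ∈ B ∨
      ∃ t ∈ B, dist (q i) (p t) ≤ 2 * (1 / 2 : ℝ) ^ s ∨
        lev t = m ∧ dist (q i) (p t) ≤ (1 / 2) ^ (m + 1) + 2 * (1 / 2) ^ s) :
    x ∈ derivedSet (p '' B) := by
  rw [mem_derivedSet, accPt_iff_nhds]
  intro U hU
  obtain ⟨ε, hε, hball⟩ := Metric.mem_nhds_iff.1 hU
  by_contra hcon
  have hiso : ∀ t ∈ B, p t ≠ x → ε ≤ dist (p t) x := by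
    intro t ht hne
    by_contra! hlt
    exact hcon ⟨p t, ⟨hball hlt, t, ht, rfl⟩, hne⟩
  -- The point `x` may itself be selected, but at most once; from level `M` on it cannot block
  -- candidates through same-level separation.
  obtain ⟨M, hM⟩ : ∃ M, ∀ t ∈ B, p t = x → lev t < M := by
    by_cases h : ∃ t ∈ B, p t = x
    · obtain ⟨t, ht, htx⟩ := h
      refine ⟨lev t + 1, fun t' ht' htx' => ?_⟩
      rcases lt_trichotomy t t' with h | rfl | h
      · exact absurd (htx'.trans htx.symm) (hinj t ht t' ht' h)
      · exact Nat.lt_succ_self _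
      · exact absurd (htx.trans htx'.symm) (hinj t' ht' t ht h)
    · exact ⟨0, fun t ht htx => absurd ⟨t, ht, htx⟩ h⟩
  obtain ⟨m, hmε, hmM⟩ := ((eventually_two_mul_pow_lt (half_pos hε)).and
    (Filter.eventually_ge_atTop M)).exists
  have hm0 : (0 : ℝ) < (1 / 2) ^ m := by positivity
  have hmem : Metric.ball x ((1 / 2) ^ m) ∈ nhds x := Metric.ball_mem_nhds x hm0
  obtain ⟨z, ⟨hz, -⟩, hzx⟩ := accPt_iff_nhds.1 (PerfectSpace.univ_preperfect (α := X) x trivial) _ hmem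
  obtain ⟨i, hi1, hi2⟩ := hq.exists_mem_open
    (Metric.isOpen_ball.inter (isOpen_compl_singleton (x := x))) ⟨z, hz, hzx⟩
  have hi1 : dist (q i) x < (1 / 2) ^ m := hi1
  have hpos : 0 < dist (q i) x := dist_pos.2 hi2
  -- The first bound stops `x` from blocking `q i` by apparent equality; the second puts any other
  -- blocker within `ε` of `x`.
  have hδ : 0 < min (dist (q i) x) (ε / 4) := by positivity
  obtain ⟨s, hs, hsδ⟩ := ((hx m i hi1).and (eventually_two_mul_pow_lt hδ)).exists
  have hs1 := hsδ.trans_le (min_le_left _ _)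
  have hs2 := hsδ.trans_le (min_le_right _ _)
  rcases hs with hs | ⟨t, ht, hs⟩
  · have := hiso _ hs (by rwa [hp])
    rw [hp] at this
    linarith
  · by_cases htx : p t = x
    · rcases hs with hs | ⟨hl, -⟩
      · rw [htx] at hs
        linarith
      · exact absurd (hM t ht htx) (by omega)
    · have h1 := hiso t ht htx
      have h2 := dist_triangle_left (p t) x (q i)
      have h3 : (1 / 2 : ℝ) ^ (m + 1) = (1 / 2) ^ m / 2 := by ring
      rcases hs with hs | ⟨-, hs⟩ <;> linarith

/-! ### The construction and its verification. -/

theorem mainTheorem8 {X : Type*} [MetricSpace X] [PerfectSpace X] (q : ℕ → X)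
    (hX : IsComputableMetricSpace X q) (C : Set X) (hC : IsPi01ClassIn q haltingSet C) :
    ∃ D : Set X, IsCESetOfSpecialPoints q D ∧ derivedSet D = C := by
  obtain ⟨I, hI, hCI⟩ := hC
  obtain ⟨R, hR, hIR⟩ := hI.isSigma2
  obtain ⟨F, hF, hsound, hcompl⟩ := hX.computable_dist.exists_test
  -- `w e` is a ball with a proposed `Σ⁰₂` witness; `d t` is a candidate (level, index, precision).
  let w : ℕ → (ℕ × ℕ) × ℕ := ofNat ((ℕ × ℕ) × ℕ)
  let d : ℕ → ℕ × ℕ × ℕ := ofNat (ℕ × ℕ × ℕ)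
  have hw : Computable w := Computable.ofNat _
  have hd : Computable d := Computable.ofNat _
  have hx : C = {x | ∀ e, (∀ n, R ((w e).1, (w e).2, n) = true) →
      (1 / 2 : ℝ) ^ (w e).1.2 ≤ dist x (q (w e).1.1)} := by
    rw [← compl_inj_iff, hCI]
    ext x
    simp only [Set.mem_iUnion, Metric.mem_ball, exists_prop, Set.mem_compl_iff, Set.mem_ofPred_eq,
      not_forall, not_le, hIR]
    constructor
    · rintro ⟨k, ⟨m, h⟩, hlt⟩
      exact ⟨encode (k, m), by simpa only [w, ofNat_encode] using h,
        by simpa only [w, ofNat_encode] using hlt⟩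
    · rintro ⟨e, h, hlt⟩
      exact ⟨_, ⟨_, h⟩, hlt⟩
  let dead : (ℕ × ℕ) → Bool := fun x =>
    !decide (∀ n < x.2, R ((w x.1).1, (w x.1).2, n) = true)
  have hdead : Computable dead := by
    refine Primrec.not.to_comp.comp (Computable.decide_forall_lt
      (p := fun x : (ℕ × ℕ) × ℕ => R ((w x.1.1).1, (w x.1.1).2, x.2)) (hR.comp ?_) Computable.snd)
    have h := hw.comp (Computable.fst.comp (Computable.fst (α := ℕ × ℕ) (β := ℕ)))
    exact (Computable.fst.comp h).pair ((Computable.snd.comp h).pair Computable.snd)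
  let T : ℕ → Bool := fun t => decide (∀ e < (d t).1, (dead (e, (d t).2.2) ||
    F (((d t).2.1, (w e).1.1), ((w e).1.2, (d t).1), (d t).2.2)) = true)
  have hT : Computable T := by
    have c1 : Computable fun x : ℕ × ℕ => d x.1 := hd.comp Computable.fst
    have c2 : Computable fun x : ℕ × ℕ => (d x.1).2.2 :=
      Computable.snd.comp (Computable.snd.comp c1)
    have c3 : Computable fun x : ℕ × ℕ => (w x.2).1 :=
      Computable.fst.comp (hw.comp Computable.snd)
    exact Computable.decide_forall_lt (p := fun x : ℕ × ℕ => dead (x.2, (d x.1).2.2) ||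
        F (((d x.1).2.1, (w x.2).1.1), ((w x.2).1.2, (d x.1).1), (d x.1).2.2))
      (Primrec.or.to_comp.comp (hdead.comp (Computable.snd.pair c2))
        (hF.comp (((Computable.fst.comp (Computable.snd.comp c1)).pair
          (Computable.fst.comp c3)).pair (((Computable.snd.comp c3).pair
            (Computable.fst.comp c1)).pair c2))))
      (Computable.fst.comp hd)
  -- Equal exponents give threshold 0, testing distinctness; exponents `m` and `m + 1` give
  -- threshold `2⁻⁽ᵐ⁺¹⁾`, testing same-level separation.
  let S : ℕ × ℕ → Bool := fun x =>
    F (((d x.2).2.1, (d x.1).2.1), ((d x.2).2.2, (d x.2).2.2), (d x.2).2.2) &&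
      (!decide ((d x.1).1 = (d x.2).1) ||
        F (((d x.2).2.1, (d x.1).2.1), ((d x.2).1, (d x.2).1 + 1), (d x.2).2.2))
  have hS : Computable S := by
    have c1 : Computable fun x : ℕ × ℕ => d x.1 := hd.comp Computable.fst
    have c2 : Computable fun x : ℕ × ℕ => d x.2 := hd.comp Computable.snd
    have l1 := Computable.fst.comp c1
    have l2 := Computable.fst.comp c2
    have s2 := Computable.snd.comp (Computable.snd.comp c2)
    have ii := (Computable.fst.comp (Computable.snd.comp c2)).pair
      (Computable.fst.comp (Computable.snd.comp c1))
    exact Primrec.and.to_comp.comp (hF.comp (ii.pair ((s2.pair s2).pair s2)))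
      (Primrec.or.to_comp.comp
        (Primrec.not.to_comp.comp (Primrec.eq.decide.to_comp.comp l1 l2))
        (hF.comp (ii.pair ((l2.pair (Computable.succ.comp l2)).pair s2))))
  obtain ⟨b, hb, hgreedy⟩ := exists_computable_greedy hT hS
  let p : ℕ → X := fun t => q (d t).2.1
  have hTt : ∀ t, T t = true ↔ ∀ e < (d t).1, dead (e, (d t).2.2) = true ∨
      F (((d t).2.1, (w e).1.1), ((w e).1.2, (d t).1), (d t).2.2) = true := fun t => by
    simp only [T, decide_eq_true_eq, Bool.or_eq_true]
  have hSt : ∀ k t, S (k, t) = true ↔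
      F (((d t).2.1, (d k).2.1), ((d t).2.2, (d t).2.2), (d t).2.2) = true ∧
      ((d k).1 = (d t).1 →
        F (((d t).2.1, (d k).2.1), ((d t).1, (d t).1 + 1), (d t).2.2) = true) := fun k t => by
    simp only [S, Bool.and_eq_true, Bool.or_eq_true, Bool.not_eq_true', decide_eq_false_iff_not,
      imp_iff_not_or]
  have hhalf : ∀ m : ℕ, (1 / 2 : ℝ) ^ m - (1 / 2) ^ (m + 1) = (1 / 2) ^ (m + 1) := fun m => by ring
  refine ⟨p '' {t | b t = true}, ⟨{i | ∃ t, b t = true ∧ (d t).2.1 = i}, ?_, ?_⟩, ?_⟩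
  · refine (REPred.of_exists (R := fun x : ℕ × ℕ => b x.2 && decide ((d x.2).2.1 = x.1)) ?_).of_eq
      fun i => by simp
    exact Primrec.and.to_comp.comp (hb.comp Computable.snd) (Primrec.eq.decide.to_comp.comp
      (Computable.fst.comp (Computable.snd.comp (hd.comp Computable.snd))) Computable.fst)
  · ext y
    constructor
    · rintro ⟨t, ht, rfl⟩
      exact ⟨_, ⟨t, ht, rfl⟩, rfl⟩
    · rintro ⟨_, ⟨t, ht, rfl⟩, rfl⟩
      exact ⟨t, ht, rfl⟩
  refine Set.Subset.antisymm (fun y => not_imp_not.1 fun hy => ?_) fun x hxC => ?_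
  · rw [hx] at hy
    simp only [Set.mem_ofPred_eq, not_forall, not_le] at hy
    obtain ⟨e, he, hlt⟩ := hy
    -- Half of the margin of `y` inside the ball pays for the error of the ball test; the other half
    -- keeps selections away from `y`.
    obtain ⟨M, hM⟩ := (eventually_two_mul_pow_lt (sub_pos.2 hlt)).exists
    refine notMem_derivedSet_of_separated_levels (lev := fun t => (d t).1) (M := max M (e + 1))
      (η := (1 / 2) ^ M) ?_ (by positivity) ?_
    · intro t ht t' ht' htt hl
      have h := ((hSt t t').1 (((hgreedy t').1 ht').2 t htt ht)).2 hl
      have h := hsound _ _ _ _ h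
      rwa [hhalf, ← hl] at h
    · intro t ht hle
      have h := ((hTt t).1 ((hgreedy t).1 ht).1 e (by omega)).resolve_left (by simp [dead, he])
      have h := hsound _ _ _ _ h
      have h2 : (1 / 2 : ℝ) ^ (d t).1 ≤ (1 / 2) ^ M :=
        pow_le_pow_of_le_one (by norm_num) (by norm_num) (by omega)
      have h3 := dist_triangle (q (d t).2.1) y (q (w e).1.1)
      simp only [p] at h ⊢
      linarith
  · rw [hx] at hxC
    refine mem_derivedSet_of_greedy hX.dense (lev := fun t => (d t).1)
      (c := fun m i s => encode (m, i, s)) ?_ (fun m i s => by simp [p, d]) ?_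
    · intro t ht t' ht' htt
      have h := ((hSt t t').1 (((hgreedy t').1 ht').2 t htt ht)).1
      have h := hsound _ _ _ _ h
      rw [sub_self] at h
      exact dist_pos.1 h
    · intro m i hmi
      have hTev : ∀ᶠ s : ℕ in Filter.atTop, T (encode (m, i, s)) = true := by
        simp only [hTt, d, ofNat_encode]
        refine (Filter.eventually_all_finite (Set.finite_Iio m)).2 fun e _ => ?_
        by_cases he : ∀ n, R ((w e).1, (w e).2, n) = true
        · have h1 := hxC e he
          have h2 := dist_triangle_left x (q (w e).1.1) (q i)
          -- Since `q i` is strictly closer to `x` than `2⁻ᵐ`, the tolerance of the test leaves room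
          -- for the approximation error.
          filter_upwards [eventually_two_mul_pow_lt (sub_pos.2 hmi)] with s hs
          exact Or.inr (hcompl _ _ _ _ (by simp only; linarith))
        · obtain ⟨n, hn⟩ := not_forall.1 he
          filter_upwards [Filter.eventually_gt_atTop n] with s hs
          exact Or.inl (by simpa [dead] using ⟨n, hs, by simpa using hn⟩)
      filter_upwards [hTev] with s hs
      by_contra! hcon
      refine hcon.1 ((hgreedy _).2 ⟨hs, fun k _ hk => (hSt _ _).2 ?_⟩)
      simp only [d, ofNat_encode]
      obtain ⟨h1, h2⟩ := hcon.2 k hk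
      refine ⟨hcompl _ _ _ _ ?_, fun hl => hcompl _ _ _ _ ?_⟩
      · rw [sub_self, zero_add]
        exact h1
      · rw [hhalf]
        exact h2 hl
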